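/- Let $M$ be an inverse monoid with a presentation $[X:\mathcal R]$. Put $A=X\sqcup X^{-1}$ and let $\mathcal R\subseteq A^*\times A^*$. Let $\rho:A^*\to \mathrm{FIM}(X)$ be the natural map onto the free inverse monoid, and $\theta:\mathrm{FIM}(X)\to M$ the presentation map, that is, a surjective homomorphism whose kernel congruence is generated by the image of $\mathcal R$ in $\mathrm{FIM}(X)$. Maps are written on the right, and $\varphi=\rho\theta: A^*\to M$. Let $\theta_{\min}$ be the congruence on $\mathrm{FIM}(X)$ for which $a\,\theta_{\min}\,b$ if and only if there is an idempotent $f$ with $af=bf$ and $(a^{-1}a)\theta=f\theta=(b^{-1}b)\theta$. Put $\mathcal T=\mathrm{FIM}(X)/\theta_{\min}$, let $\tau:\mathrm{FIM}(X)\to\mathcal T$ be the quotient map, and let $\psi:\mathcal T\to M$ be the induced map, so that $\theta=\tau\psi$. The map $\psi$ is idempotent separating, and every idempotent $e$ of $M$ has a unique idempotent preimage $\tilde e\in E(\mathcal T)$ under $\psi$. The part $K_e=\{a\in\mathcal T: a\psi=e\}$ of $\ker\psi=\{a\in\mathcal T : a\psi\in E(M)\}$ is a group with identity $\tilde e$.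 The left Schützenberger graph of $(M,X)$ has vertex set $M$ and, for $x\in X$ and $s\in M$, an $x$-labelled edge from $s$ to $(x\theta)s$ whenever $(x^{-1}x)\theta\geqslant ss^{-1}$; traversed backwards this edge has label $x^{-1}$. For an idempotent $e$ of $M$ let $\mathrm{Sch}(M,X,e)$ be the full subgraph on the $\mathcal L$-class of $e$, and let $\pi_e=\pi_1(\mathrm{Sch}(M,X,e),e)$ be its fundamental group: the edge paths from $e$ to $e$ up to insertion and deletion of subpaths consisting of an edge followed by its inverse, multiplied by concatenation. Let $U_e=\{w\in A^*: w\varphi\geqslant e\}$, and write $\mathrm{rev}(w)$ for the reverse of a word $w$. Then, for each idempotent $e$ of $M$, mapping a closed path at $e$ in $\mathrm{Sch}(M,X,e)$ to its label is a bijection onto the set of words $w\in A^*$ with $\mathrm{rev}(w)\in U_e$. Writing $[w]\in\pi_e$ for the homotopy class of the closed path labelled $w$, there is a group isomorphism $\kappa_e:\pi_e\to K_e$ such that for all such $w$ $$[w]\,\kappa_e=\big[(\mathrm{rev}(w)\rho\tau)\,\tilde e\,\big]^{-1}.$$ -/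

import Mathlib

universe u v

/-- An inverse monoid: a monoid in which every element `a` has a unique inverse `a⁻¹`, that is, a
unique element `b` with `a * b * a = a` and `b * a * b = b`. -/
class InverseMonoid (S : Type u) extends Monoid S, Inv S where
  mul_inv_mul : ∀ a : S, a * a⁻¹ * a = a
  inv_mul_inv : ∀ a : S, a⁻¹ * a * a⁻¹ = a⁻¹
  inv_unique : ∀ a b : S, a * b * a = a → b * a * b = b → b = a⁻¹

namespace InverseMonoid

section Basic

variable {S : Type u} [InverseMonoid S]

theorem inv_inv' (a : S) : a⁻¹⁻¹ = a :=
  (inv_unique a⁻¹ a (inv_mul_inv a) (mul_inv_mul a)).symm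

theorem inv_of_idem {e : S} (he : IsIdempotentElem e) : e⁻¹ = e :=
  (inv_unique e e (by rw [he.eq, he.eq]) (by rw [he.eq, he.eq])).symm

theorem idem_mul_idem {e f : S} (he : IsIdempotentElem e) (hf : IsIdempotentElem f) :
    IsIdempotentElem (e * f) := by
  have h1 : ∀ z : S, e * (e * z) = e * z := fun z => by rw [← mul_assoc, he.eq]
  have h2 : ∀ z : S, f * (f * z) = f * z := fun z => by rw [← mul_assoc, hf.eq]
  have h3 := mul_inv_mul (e * f)
  have h4 := inv_mul_inv (e * f)
  have key : f * (e * f)⁻¹ * e = (e * f)⁻¹ := by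
    apply inv_unique
    · simp only [mul_assoc, h1, h2] at h3 ⊢
      exact h3
    · have := congrArg (fun z => f * z * e) h4
      simp only [mul_assoc, h1, h2] at this ⊢
      exact this
  have hx : IsIdempotentElem (e * f)⁻¹ := by
    have := congrArg (fun z => f * z * e) h4
    unfold IsIdempotentElem
    calc (e * f)⁻¹ * (e * f)⁻¹ = (f * (e * f)⁻¹ * e) * (f * (e * f)⁻¹ * e) := by rw [key]
      _ = f * ((e * f)⁻¹ * (e * f) * (e * f)⁻¹) * e := by simp only [mul_assoc]
      _ = (e * f)⁻¹ := by rw [h4, key]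
  have := inv_of_idem hx
  rw [inv_inv'] at this
  rw [this]
  exact hx

theorem idem_comm {e f : S} (he : IsIdempotentElem e) (hf : IsIdempotentElem f) :
    e * f = f * e := by
  have h1 : ∀ z : S, e * (e * z) = e * z := fun z => by rw [← mul_assoc, he.eq]
  have h2 : ∀ z : S, f * (f * z) = f * z := fun z => by rw [← mul_assoc, hf.eq]
  have hef := idem_mul_idem he hf
  have hfe := idem_mul_idem hf he
  have : f * e = (e * f)⁻¹ := by
    apply inv_unique
    · have := hef.eq
      simp only [mul_assoc, h1, h2] at this ⊢
      exact this
    · have := hfe.eq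
      simp only [mul_assoc, h1, h2] at this ⊢
      exact this
  rw [this, inv_of_idem hef]

theorem idem_mul_inv (a : S) : IsIdempotentElem (a * a⁻¹) := by
  unfold IsIdempotentElem
  rw [← mul_assoc, mul_inv_mul]

theorem idem_inv_mul (a : S) : IsIdempotentElem (a⁻¹ * a) := by
  unfold IsIdempotentElem
  rw [← mul_assoc, inv_mul_inv]

theorem mul_inv_rev' (a b : S) : (a * b)⁻¹ = b⁻¹ * a⁻¹ := by
  have hc := idem_comm (idem_mul_inv b) (idem_inv_mul a)
  symm
  apply inv_unique
  · calc a * b * (b⁻¹ * a⁻¹) * (a * b) = a * ((b * b⁻¹) * (a⁻¹ * a)) * b := by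
          simp only [mul_assoc]
      _ = (a * a⁻¹ * a) * (b * b⁻¹ * b) := by rw [hc]; simp only [mul_assoc]
      _ = a * b := by rw [mul_inv_mul, mul_inv_mul]
  · calc b⁻¹ * a⁻¹ * (a * b) * (b⁻¹ * a⁻¹) = b⁻¹ * ((a⁻¹ * a) * (b * b⁻¹)) * a⁻¹ := by
          simp only [mul_assoc]
      _ = (b⁻¹ * b * b⁻¹) * (a⁻¹ * a * a⁻¹) := by rw [← hc]; simp only [mul_assoc]
      _ = b⁻¹ * a⁻¹ := by rw [inv_mul_inv, inv_mul_inv]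

theorem idem_conj {e : S} (he : IsIdempotentElem e) (a : S) :
    IsIdempotentElem (a * e * a⁻¹) := by
  have hc := idem_comm (idem_inv_mul a) he
  unfold IsIdempotentElem
  calc a * e * a⁻¹ * (a * e * a⁻¹) = a * (e * ((a⁻¹ * a) * e)) * a⁻¹ := by simp only [mul_assoc]
    _ = a * (e * (e * (a⁻¹ * a))) * a⁻¹ := by rw [hc]
    _ = a * e * (a⁻¹ * a * a⁻¹) := by rw [← mul_assoc e, he.eq]; simp only [mul_assoc]
    _ = a * e * a⁻¹ := by rw [inv_mul_inv]

theorem map_inv' {T : Type v} [InverseMonoid T] (f : S →* T) (a : S) : f a⁻¹ = (f a)⁻¹ := by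
  apply inv_unique
  · rw [← map_mul, ← map_mul, mul_inv_mul]
  · rw [← map_mul, ← map_mul, inv_mul_inv]

/-- The natural partial order: `a ≤ b` iff `a = b * e` for some idempotent `e`. -/
def NatLE (a b : S) : Prop := ∃ e : S, IsIdempotentElem e ∧ a = b * e

/-- Green's relation `L` of an inverse monoid. -/
def GreenL (a b : S) : Prop := a⁻¹ * a = b⁻¹ * b

end Basic

/-- The equational description of inverse monoids. -/
@[reducible] def ofEquations (S : Type u) [Monoid S] [Inv S]
    (h1 : ∀ a : S, a * a⁻¹ * a = a) (h2 : ∀ a : S, a⁻¹⁻¹ = a)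
    (h3 : ∀ a b : S, (a * b)⁻¹ = b⁻¹ * a⁻¹)
    (h4 : ∀ a b : S, a * a⁻¹ * (b * b⁻¹) = b * b⁻¹ * (a * a⁻¹)) : InverseMonoid S :=
  have h5 : ∀ a : S, a⁻¹ * a * a⁻¹ = a⁻¹ := fun a => by
    have := h1 a⁻¹
    rwa [h2] at this
  have hid : ∀ e : S, e * e = e → e = e * e⁻¹ := fun e he => by
    have hi : e⁻¹ * e⁻¹ = e⁻¹ := by rw [← h3, he]
    have hc := h4 e⁻¹ e
    rw [h2] at hc
    have : e⁻¹ = e := by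
      calc e⁻¹ = e⁻¹ * (e * e) * e⁻¹ := by rw [he, h5]
        _ = e⁻¹ * e * (e * e⁻¹) := by simp only [mul_assoc]
        _ = e * (e⁻¹ * e⁻¹) * e := by rw [hc]; simp only [mul_assoc]
        _ = e := by rw [hi, h1]
    rw [this, he]
  have hcomm : ∀ e f : S, e * e = e → f * f = f → e * f = f * e := fun e f he hf => by
    rw [hid e he, hid f hf]
    exact h4 e f
  { mul_inv_mul := h1
    inv_mul_inv := h5
    inv_unique := fun a b hab hba => by
      have i1 : b * a * (b * a) = b * a := by rw [← mul_assoc, hba]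
      have i2 : a⁻¹ * a * (a⁻¹ * a) = a⁻¹ * a := by rw [← mul_assoc, h5]
      have i3 : a * b * (a * b) = a * b := by rw [← mul_assoc, hab]
      have i4 : a * a⁻¹ * (a * a⁻¹) = a * a⁻¹ := by rw [← mul_assoc, h1]
      have e1 : b = a⁻¹ * a * b := by
        calc b = b * (a * a⁻¹ * a) * b := by rw [h1, hba]
          _ = (b * a) * (a⁻¹ * a) * b := by simp only [mul_assoc]
          _ = (a⁻¹ * a) * (b * a * b) := by rw [hcomm _ _ i1 i2]; simp only [mul_assoc]
          _ = a⁻¹ * a * b := by rw [hba]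
      calc b = a⁻¹ * a * b := e1
        _ = a⁻¹ * ((a * a⁻¹) * (a * b)) := by
            rw [← mul_assoc (a * a⁻¹), h1, mul_assoc]
        _ = a⁻¹ * (a * b * a) * a⁻¹ := by rw [hcomm _ _ i4 i3]; simp only [mul_assoc]
        _ = a⁻¹ := by rw [hab, h5] }

/-- The congruence `ρ_min` attached to a congruence `ρ`:
`a ρ_min b` iff there is an idempotent `e` with `a e = b e` and `a⁻¹ a ρ e ρ b⁻¹ b`. -/
def minCon {S : Type u} [InverseMonoid S] (r : Con S) : Con S where
  r a b := ∃ e : S, IsIdempotentElem e ∧ a * e = b * e ∧ r (a⁻¹ * a) e ∧ r e (b⁻¹ * b)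
  iseqv :=
    { refl := fun a => ⟨a⁻¹ * a, idem_inv_mul a, rfl, r.refl _, r.refl _⟩
      symm := fun ⟨e, he, h, h1, h2⟩ => ⟨e, he, h.symm, r.symm h2, r.symm h1⟩
      trans := by
        rintro a b c ⟨e, he, h, h1, h2⟩ ⟨f, hf, k, k1, k2⟩
        have hef : r e f := r.trans h2 k1
        have hee : r e (e * f) := by
          have := r.mul (r.refl e) hef
          rwa [he.eq] at this
        refine ⟨e * f, idem_mul_idem he hf, ?_, r.trans h1 hee,
          r.trans (r.symm hee) (r.trans hef k2)⟩
        rw [← mul_assoc, h, idem_comm he hf, ← mul_assoc, ← k, mul_assoc, mul_assoc,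
          idem_comm he hf] }
  mul' := by
    rintro a b c d ⟨e, he, h, h1, h2⟩ ⟨f, hf, k, k1, k2⟩
    have hk : f * c⁻¹ = f * d⁻¹ := by
      have := congrArg (fun z => z⁻¹) k
      simpa only [mul_inv_rev', inv_of_idem hf] using this
    have hg : f * c⁻¹ * e * c * f = f * d⁻¹ * e * d * f := by
      rw [hk, mul_assoc _ c f, k, mul_assoc _ d f]
    have gen : ∀ z : S, z * (f * z⁻¹ * e * z * f) = e * (z * f) := fun z => by
      have hi := idem_mul_inv (z * f)
      rw [mul_inv_rev', inv_of_idem hf] at hi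
      calc z * (f * z⁻¹ * e * z * f) = (z * f * (f * z⁻¹)) * e * (z * f) := by
            rw [← mul_assoc (z * f) f, mul_assoc z f f, hf.eq]; simp only [mul_assoc]
        _ = e * (z * f * (z * f)⁻¹ * (z * f)) := by
            rw [idem_comm hi he, mul_inv_rev', inv_of_idem hf]; simp only [mul_assoc]
        _ = e * (z * f) := by rw [mul_inv_mul]
    have hid : IsIdempotentElem (f * c⁻¹ * e * c * f) := by
      have := idem_conj he (f * c⁻¹)
      rw [mul_inv_rev', inv_inv', inv_of_idem hf] at this
      simpa only [mul_assoc] using this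
    have cls : ∀ x z : S, r (x⁻¹ * x) e → r (z⁻¹ * z) f →
        r ((x * z)⁻¹ * (x * z)) (f * z⁻¹ * e * z * f) := fun x z hx hz => by
      have s1 : r (z⁻¹ * (x⁻¹ * x) * z) (z⁻¹ * e * z) :=
        r.mul (r.mul (r.refl _) hx) (r.refl _)
      have s2 : r ((z⁻¹ * z) * (z⁻¹ * e * z) * (z⁻¹ * z)) (f * (z⁻¹ * e * z) * f) :=
        r.mul (r.mul hz (r.refl _)) hz
      have e2 : (z⁻¹ * z) * (z⁻¹ * e * z) * (z⁻¹ * z) = z⁻¹ * e * z := by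
        calc (z⁻¹ * z) * (z⁻¹ * e * z) * (z⁻¹ * z)
            = (z⁻¹ * z * z⁻¹) * e * (z * z⁻¹ * z) := by simp only [mul_assoc]
          _ = z⁻¹ * e * z := by rw [inv_mul_inv, mul_inv_mul]
      rw [e2] at s2
      have := r.trans s1 s2
      rw [mul_inv_rev']
      simpa only [mul_assoc] using this
    refine ⟨f * c⁻¹ * e * c * f, hid, ?_, cls a c h1 k1, ?_⟩
    · rw [mul_assoc a, mul_assoc b, gen, hg, gen, ← mul_assoc, ← mul_assoc, h, mul_assoc, k,
        mul_assoc]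
    · rw [hg]
      exact r.symm (cls b d (r.symm h2) (r.symm k2))

section MinQuotient

variable {S : Type u} [InverseMonoid S] (r : Con S)

theorem minCon_inv {a b : S} (hab : minCon r a b) : minCon r a⁻¹ b⁻¹ := by
  obtain ⟨e, he, h, h1, h2⟩ := hab
  have hi : e * a⁻¹ = e * b⁻¹ := by
    have := congrArg (fun z => z⁻¹) h
    simpa only [mul_inv_rev', inv_of_idem he] using this
  have hf : a * e * a⁻¹ = b * e * b⁻¹ := by rw [mul_assoc, hi, ← mul_assoc, h]
  have gen : ∀ z : S, z⁻¹ * (z * e * z⁻¹) = e * z⁻¹ := fun z => by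
    calc z⁻¹ * (z * e * z⁻¹) = (z⁻¹ * z) * e * z⁻¹ := by simp only [mul_assoc]
      _ = e * (z⁻¹ * z * z⁻¹) := by rw [idem_comm (idem_inv_mul z) he]; simp only [mul_assoc]
      _ = e * z⁻¹ := by rw [inv_mul_inv]
  have cls : ∀ z : S, r (z⁻¹ * z) e → r (z⁻¹⁻¹ * z⁻¹) (z * e * z⁻¹) := fun z hz => by
    have := r.mul (r.mul (r.refl z) hz) (r.refl z⁻¹)
    rw [← mul_assoc, mul_inv_mul] at this
    rwa [inv_inv']
  refine ⟨a * e * a⁻¹, idem_conj he a, ?_, cls a h1, ?_⟩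
  · rw [gen, hf, gen, hi]
  · rw [hf]
    exact r.symm (cls b (r.symm h2))

theorem minCon_le : minCon r ≤ r := by
  rintro a b ⟨e, he, h, h1, h2⟩
  have s1 : r a (a * e) := by
    have := r.mul (r.refl a) h1
    rwa [← mul_assoc, mul_inv_mul] at this
  have s2 : r (b * e) b := by
    have := r.mul (r.refl b) h2
    rwa [← mul_assoc b, mul_inv_mul] at this
  rw [h] at s1
  exact r.trans s1 s2

/-- `S / ρ_min` is an inverse monoid, with inverses computed on representatives. -/
instance minQuotient : InverseMonoid (minCon r).Quotient :=
  letI : Inv (minCon r).Quotient :=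
    ⟨fun q => Con.liftOn q (fun a => ((a⁻¹ : S) : (minCon r).Quotient))
      fun _ _ h => (minCon r).eq.2 (minCon_inv r h)⟩
  ofEquations (minCon r).Quotient
    (by
      intro a
      induction a using Con.induction_on with | H a => ?_
      exact congrArg (fun z : S => (z : (minCon r).Quotient)) (mul_inv_mul a))
    (by
      intro a
      induction a using Con.induction_on with | H a => ?_
      exact congrArg (fun z : S => (z : (minCon r).Quotient)) (inv_inv' a))
    (by
      intro a b
      induction a using Con.induction_on with | H a => ?_
      induction b using Con.induction_on with | H b => ?_
      exact congrArg (fun z : S => (z : (minCon r).Quotient)) (mul_inv_rev' a b))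
    (by
      intro a b
      induction a using Con.induction_on with | H a => ?_
      induction b using Con.induction_on with | H b => ?_
      exact congrArg (fun z : S => (z : (minCon r).Quotient))
        (idem_comm (idem_mul_inv a) (idem_mul_inv b)))

end MinQuotient

/-! ### Words, the Wagner congruence and the free inverse monoid -/

/-- The free monoid `A*` on `A = X ⊔ X⁻¹`: `Sum.inl x` is the letter `x`, and `Sum.inr x` is the
letter `x⁻¹`. -/
abbrev Words (X : Type u) := FreeMonoid (X ⊕ X)

/-- The formal inverse of a word: reverse it and invert each of its letters. -/
def wordInv {X : Type u} (w : Words X) : Words X := (FreeMonoid.map Sum.swap w).reverse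

theorem wordInv_mul {X : Type u} (a b : Words X) : wordInv (a * b) = wordInv b * wordInv a := by
  rw [wordInv, map_mul, FreeMonoid.reverse_mul]
  rfl

theorem wordInv_wordInv {X : Type u} (a : Words X) : wordInv (wordInv a) = a := by
  have : ∀ l : List (X ⊕ X), ((l.map Sum.swap).reverse.map Sum.swap).reverse = l := fun l => by
    simp [← List.map_reverse]
  exact this a

/-- The generating pairs of the Wagner congruence. -/
inductive WagnerRel (X : Type u) : Words X → Words X → Prop
  | regular (w : Words X) : WagnerRel X (w * wordInv w * w) w
  | commute (w z : Words X) :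
      WagnerRel X (w * wordInv w * (z * wordInv z)) (z * wordInv z * (w * wordInv w))

/-- The Wagner congruence on `A*`. -/
def wagnerCon (X : Type u) : Con (Words X) := conGen (WagnerRel X)

/-- The free inverse monoid on `X`. -/
def FIM (X : Type u) : Type u := (wagnerCon X).Quotient

theorem wagnerCon_inv {X : Type u} {a b : Words X} (h : wagnerCon X a b) :
    wagnerCon X (wordInv a) (wordInv b) := by
  change ConGen.Rel (WagnerRel X) a b at h
  induction h with
  | of a b hab =>
    apply ConGen.Rel.of
    cases hab with
    | regular w =>
      have := WagnerRel.regular (wordInv b)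
      simpa only [wordInv_mul, wordInv_wordInv, mul_assoc] using this
    | commute w z =>
      have := WagnerRel.commute z w
      simpa only [wordInv_mul, wordInv_wordInv, mul_assoc] using this
  | refl a => exact (wagnerCon X).refl _
  | symm h ih => exact (wagnerCon X).symm (ih)
  | trans h k ih1 ih2 => exact (wagnerCon X).trans ih1 ih2
  | mul h k ih1 ih2 =>
    rw [wordInv_mul, wordInv_mul]
    exact (wagnerCon X).mul ih2 ih1

/-- The free inverse monoid is an inverse monoid, with inverses computed on words. -/
instance instFIM (X : Type u) : InverseMonoid (FIM X) :=
  letI : Monoid (FIM X) := inferInstanceAs (Monoid (wagnerCon X).Quotient)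
  letI : Inv (FIM X) :=
    ⟨fun q => Con.liftOn q (fun a => ((wordInv a : Words X) : (wagnerCon X).Quotient))
      fun _ _ h => (wagnerCon X).eq.2 (wagnerCon_inv h)⟩
  ofEquations (FIM X)
    (by
      intro a
      induction a using Con.induction_on with | H a => ?_
      exact (wagnerCon X).eq.2 (ConGen.Rel.of _ _ (WagnerRel.regular a)))
    (by
      intro a
      induction a using Con.induction_on with | H a => ?_
      exact congrArg (fun z : Words X => (z : (wagnerCon X).Quotient)) (wordInv_wordInv a))
    (by
      intro a b
      induction a using Con.induction_on with | H a => ?_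
      induction b using Con.induction_on with | H b => ?_
      exact congrArg (fun z : Words X => (z : (wagnerCon X).Quotient)) (wordInv_mul a b))
    (by
      intro a b
      induction a using Con.induction_on with | H a => ?_
      induction b using Con.induction_on with | H b => ?_
      exact (wagnerCon X).eq.2 (ConGen.Rel.of _ _ (WagnerRel.commute a b)))

/-- The natural map `ρ : A* → FIM(X)`. -/
def rho (X : Type u) : Words X →* FIM X := (wagnerCon X).mk'

/-- The generator of `FIM(X)` given by `x`. -/
def FIM.of {X : Type u} (x : X) : FIM X := rho X (FreeMonoid.of (Sum.inl x))

end InverseMonoid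

open InverseMonoid in
/-- A presentation `[X : R]` of the inverse monoid `M`, with its presentation map `θ`: relations
`R ⊆ A* × A*`, and a surjective homomorphism `θ : FIM(X) → M` whose kernel congruence is the
congruence generated by (the image in `FIM(X)` of) `R`. -/
structure InverseMonoidPresentation (X : Type u) (M : Type v) [InverseMonoid M] where
  rels : Set (Words X × Words X)
  theta : FIM X →* M
  surjective : Function.Surjective theta
  ker_eq : Con.ker theta =
    conGen (fun a b : FIM X => ∃ l r : Words X, (l, r) ∈ rels ∧ a = rho X l ∧ b = rho X r)

namespace InverseMonoidPresentation

open InverseMonoid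

variable {X : Type u} {M : Type v} [InverseMonoid M] (P : InverseMonoidPresentation X M)

/-- The canonical map `φ = ρ θ : A* → M`. -/
def phi : Words X →* M := P.theta.comp (rho X)

/-- The inverse monoid `T(M,X) = FIM(X) / θ_min`. -/
abbrev T : Type u := (minCon (Con.ker P.theta)).Quotient

/-- The quotient map `τ : FIM(X) → T(M,X)`. -/
def tau : FIM X →* P.T := (minCon (Con.ker P.theta)).mk'

/-- The homomorphism `ψ : T(M,X) → M` with `θ = τ ψ`. -/
def psi : P.T →* M := (minCon (Con.ker P.theta)).lift P.theta (minCon_le _)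

theorem psi_tau (a : FIM X) : P.psi (P.tau a) = P.theta a := rfl

theorem tau_surjective : Function.Surjective P.tau := Con.mk'_surjective

theorem psi_idem_sep {f g : P.T} (hf : IsIdempotentElem f) (hg : IsIdempotentElem g)
    (h : P.psi f = P.psi g) : f = g := by
  obtain ⟨a, rfl⟩ := P.tau_surjective f
  obtain ⟨b, rfl⟩ := P.tau_surjective g
  have ha : P.tau a = P.tau (a⁻¹ * a) := by
    rw [map_mul, map_inv', inv_of_idem hf, hf.eq]
  have hb : P.tau b = P.tau (b⁻¹ * b) := by
    rw [map_mul, map_inv', inv_of_idem hg, hg.eq]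
  rw [ha, hb] at h ⊢
  rw [psi_tau, psi_tau] at h
  have ia := idem_inv_mul a
  have ib := idem_inv_mul b
  generalize a⁻¹ * a = e at *
  generalize b⁻¹ * b = k at *
  refine (minCon (Con.ker P.theta)).eq.2 ⟨e * k, idem_mul_idem ia ib, ?_, ?_, ?_⟩
  · rw [← mul_assoc, ia.eq, idem_comm ia ib, ← mul_assoc, ib.eq]
  · rw [inv_of_idem ia, ia.eq, Con.ker_rel, map_mul, ← h, ← map_mul, ia.eq]
  · rw [inv_of_idem ib, ib.eq, Con.ker_rel, map_mul, h, ← map_mul, ib.eq]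

/-- Every idempotent of `M` has exactly one idempotent preimage under `ψ`. -/
theorem existsUnique_idem_preimage (e : {e : M // IsIdempotentElem e}) :
    ∃! f : P.T, IsIdempotentElem f ∧ P.psi f = e := by
  obtain ⟨a, ha⟩ := P.surjective e.1
  refine ⟨P.tau (a⁻¹ * a), ⟨?_, ?_⟩, ?_⟩
  · unfold IsIdempotentElem
    rw [← map_mul, (idem_inv_mul a).eq]
  · rw [psi_tau, map_mul, map_inv', ha, inv_of_idem e.2, e.2.eq]
  · rintro f ⟨hf, hfe⟩
    apply P.psi_idem_sep hf
    · unfold IsIdempotentElem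
      rw [← map_mul, (idem_inv_mul a).eq]
    · rw [hfe, psi_tau, map_mul, map_inv', ha, inv_of_idem e.2, e.2.eq]

/-- `ẽ`: the unique idempotent of `T(M,X)` that `ψ` maps to the idempotent `e` of `M`. -/
noncomputable def tilde (e : {e : M // IsIdempotentElem e}) : P.T :=
  (P.existsUnique_idem_preimage e).choose

theorem tilde_idem (e : {e : M // IsIdempotentElem e}) : IsIdempotentElem (P.tilde e) :=
  (P.existsUnique_idem_preimage e).choose_spec.1.1

theorem psi_tilde (e : {e : M // IsIdempotentElem e}) : P.psi (P.tilde e) = e :=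
  (P.existsUnique_idem_preimage e).choose_spec.1.2

/-- The part `K_e = {a ∈ T(M,X) : a ψ = e}` of the kernel of `ψ` over the idempotent `e`. -/
def K (e : {e : M // IsIdempotentElem e}) : Type u := {a : P.T // P.psi a = e}

/-- `K_e` is a group under the multiplication of `T(M,X)`, with identity `ẽ` and with the inverses
of `T(M,X)`. -/
noncomputable instance instGroupK (e : {e : M // IsIdempotentElem e}) : Group (P.K e) :=
  have hl : ∀ a : P.T, P.psi a = e → a⁻¹ * a = P.tilde e := fun a ha =>
    P.psi_idem_sep (idem_inv_mul a) (P.tilde_idem e) (by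
      rw [map_mul, map_inv', ha, psi_tilde, inv_of_idem e.2, e.2.eq])
  have hr : ∀ a : P.T, P.psi a = e → a * a⁻¹ = P.tilde e := fun a ha =>
    P.psi_idem_sep (idem_mul_inv a) (P.tilde_idem e) (by
      rw [map_mul, map_inv', ha, psi_tilde, inv_of_idem e.2, e.2.eq])
  letI : Mul (P.K e) := ⟨fun a b => ⟨a.1 * b.1, by rw [map_mul, a.2, b.2, e.2.eq]⟩⟩
  letI : One (P.K e) := ⟨⟨P.tilde e, P.psi_tilde e⟩⟩
  letI : Inv (P.K e) := ⟨fun a => ⟨a.1⁻¹, by rw [map_inv', a.2, inv_of_idem e.2]⟩⟩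
  Group.ofLeftAxioms (fun a b c => Subtype.ext (mul_assoc a.1 b.1 c.1))
    (fun a => Subtype.ext (by
      change P.tilde e * a.1 = a.1
      rw [← hr a.1 a.2, mul_inv_mul]))
    (fun a => Subtype.ext (hl a.1 a.2))

/-- `U_e = {w ∈ A* : w φ ≥ e}`. -/
def U (e : {e : M // IsIdempotentElem e}) : Set (Words X) := {w | NatLE e.1 (P.phi w)}

/-! ### Left Schützenberger graphs -/

/-- The vertex set `M` of the left Schützenberger graph `Sch(M,X)`. -/
@[nolint unusedArguments]
def Sch (_P : InverseMonoidPresentation X M) : Type v := M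

/-- The left Schützenberger graph: for `s ∈ M` and `x ∈ X` there is an `x`-labelled edge from `s`
to `(x θ) s` whenever `(x⁻¹ x) θ ≥ s s⁻¹`. -/
instance instQuiverSch : Quiver P.Sch where
  Hom (s t : M) := {x : X //
    NatLE (s * s⁻¹) (P.theta ((FIM.of x)⁻¹ * FIM.of x)) ∧ t = P.theta (FIM.of x) * s}

/-- The vertex set of the component `Sch(M,X,e)`: the `L`-class of `e` in `M`. -/
def SchComp (e : {e : M // IsIdempotentElem e}) : Type v :=
  {s : P.Sch // GreenL (S := M) s e.1}

/-- `Sch(M,X,e)` is the full subgraph of `Sch(M,X)` on the `L`-class of `e`. -/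
instance instQuiverSchComp (e : {e : M // IsIdempotentElem e}) : Quiver (P.SchComp e) where
  Hom s t := s.1 ⟶ t.1

/-- The vertex `e` of `Sch(M,X,e)`. -/
def base (e : {e : M // IsIdempotentElem e}) : P.SchComp e := ⟨e.1, rfl⟩

/-- An edge of `Sch(M,X,e)` traversed forwards or backwards (an arrow of the symmetrified quiver),
and its label in `A = X ⊔ X⁻¹`. -/
def letter {e : {e : M // IsIdempotentElem e}} {s t : Quiver.Symmetrify (P.SchComp e)} :
    (s ⟶ t) → X ⊕ X
  | Sum.inl x => Sum.inl x.1
  | Sum.inr x => Sum.inr x.1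

/-- The label in `A*` of an edge path in `Sch(M,X,e)`. -/
def label {e : {e : M // IsIdempotentElem e}} {s : Quiver.Symmetrify (P.SchComp e)} :
    {t : Quiver.Symmetrify (P.SchComp e)} → Quiver.Path s t → Words X
  | _, Quiver.Path.nil => 1
  | _, Quiver.Path.cons p a => label p * FreeMonoid.of (P.letter a)

/-- Closed edge paths at `e` in `Sch(M,X,e)`. -/
abbrev ClosedPath (e : {e : M // IsIdempotentElem e}) :=
  @Quiver.Path (Quiver.Symmetrify (P.SchComp e)) _ (P.base e) (P.base e)

/-- The fundamental group `π_e = π₁(Sch(M,X,e), e)`: the local group at `e` of the free groupoid on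
the graph `Sch(M,X,e)`, whose elements are the edge paths from `e` to `e` modulo insertion and
deletion of subpaths `a a⁻¹`, multiplied by concatenation. -/
abbrev FundGroup (e : {e : M // IsIdempotentElem e}) :=
  (Quiver.FreeGroupoid.of (P.SchComp e)).obj (P.base e) ⟶
    (Quiver.FreeGroupoid.of (P.SchComp e)).obj (P.base e)

/-- The homotopy class of a closed path. -/
def homotopyClass {e : {e : M // IsIdempotentElem e}} (p : P.ClosedPath e) : P.FundGroup e :=
  (CategoryTheory.Quotient.functor
    (@Quiver.FreeGroupoid.redStep (P.SchComp e) _)).map p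

end InverseMonoidPresentation

/-! On the `L`-class of `e`, every letter of `A` acts by left multiplication as a partial injection,
inverse letters acting as inverse maps, and the edges record this action. A start vertex and a word
therefore determine at most one path (`label_injective`). Its end is reached by multiplying by the
reversed word, since the first letter acts first. The path exists as soon as that end lies in the
`L`-class (`exists_path`), because left multiplication only descends and so cannot leave the class
and come back. Hence `w` labels a closed path at `e` exactly when `(rev w)φ` fixes `e`, that is,
when `rev w` lies in `U_e`.

Send a closed path labelled `w` to `(rev w)ρτ · ẽ` in `K_e`. A detour along an edge and back
multiplies by an idempotent whose `ψ`-image fixes the current vertex. As `ψ` separates idempotents,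
this idempotent acts as the identity over that vertex, so the value depends only on the homotopy
class (`pathValue_congr_redStep`). Reading backwards gives an anti-homomorphism, and inversion in
`K_e` corrects this. It is onto because any word representing an element of `K_e` is mapped to `e`
by `φ`.

Injectivity uses the minimality of `θ_min`. If `p` has value `ẽ`, there is an element of `FIM(X)`
over `e` that is fixed by left multiplication by the reversed label of `p`. It is read off some
closed path `q`, so the labels of `qp` and `q` agree in `FIM(X)` after reversal. Words whose
reverses agree in `FIM(X)` label homotopic paths (`pathClass_eq_of_rho_eq`), since the Wagner
relations only remove or permute detours. Cancelling `q` shows that `p` is null-homotopic. -/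

namespace InverseMonoid

/-! ### Left multiplication, the natural order and `L`-classes -/

section

variable {S : Type u} [InverseMonoid S]

theorem NatLE.mul_eq {e m : S} (he : IsIdempotentElem e) (h : NatLE e m) : m * e = e := by
  obtain ⟨f, hf, h⟩ := h
  have h1 : e * f = e := by
    rw [h, mul_assoc, hf.eq]
  have h2 : f * e = e := by rw [← idem_comm he hf, h1]
  calc m * e = m * (f * e) := by rw [h2]
    _ = m * f * e := (mul_assoc _ _ _).symm
    _ = e := by rw [← h, he.eq]

/-- If `s`, `b * s` and `a * (b * s)` start and end in one `L`-class, so does `b * s`. -/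
theorem GreenL.of_mul_mul {a b s e : S} (hs : GreenL s e) (h : GreenL (a * (b * s)) e) :
    GreenL (b * s) e := by
  unfold GreenL at *
  -- Left multiplication can only lower the idempotent `x⁻¹ * x`. That of `b * s` is thus squeezed
  -- between those of `a * (b * s)` and `s`, both equal to `e⁻¹ * e`.
  have h1 : e⁻¹ * e * ((b * s)⁻¹ * (b * s)) = e⁻¹ * e := by
    rw [← h, mul_inv_rev' a (b * s)]
    calc (b * s)⁻¹ * a⁻¹ * (a * (b * s)) * ((b * s)⁻¹ * (b * s))
        = (b * s)⁻¹ * a⁻¹ * a * ((b * s) * (b * s)⁻¹ * (b * s)) := by simp only [mul_assoc]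
      _ = (b * s)⁻¹ * a⁻¹ * (a * (b * s)) := by rw [mul_inv_mul]; simp only [mul_assoc]
  have h2 : (b * s)⁻¹ * (b * s) * (e⁻¹ * e) = (b * s)⁻¹ * (b * s) := by
    rw [← hs]
    calc (b * s)⁻¹ * (b * s) * (s⁻¹ * s) = (b * s)⁻¹ * b * (s * s⁻¹ * s) := by
          simp only [mul_assoc]
      _ = (b * s)⁻¹ * (b * s) := by rw [mul_inv_mul]; simp only [mul_assoc]
  rw [← h2, idem_comm (idem_inv_mul _) (idem_inv_mul _), h1]

/-- Conjugating the `L`-relation by `s` and commuting idempotents shows that `m⁻¹ * m` lies above `s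
* s⁻¹`. So a step that stays in the `L`-class satisfies the edge condition and can be undone. -/
theorem inv_mul_mul_cancel_of_greenL {m s : S} (h : GreenL (m * s) s) : m⁻¹ * (m * s) = s := by
  unfold GreenL at h
  rw [mul_inv_rev'] at h
  have hc := idem_comm (idem_inv_mul m) (idem_mul_inv s)
  calc m⁻¹ * (m * s) = (m⁻¹ * m) * (s * s⁻¹ * s) := by rw [mul_inv_mul, mul_assoc]
    _ = (m⁻¹ * m) * (s * s⁻¹) * (s * s⁻¹ * s) := by
        rw [mul_inv_mul]; simp only [mul_assoc]; rw [← mul_assoc s, mul_inv_mul]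
    _ = s * (s⁻¹ * m⁻¹ * (m * s)) * (s⁻¹ * s) := by rw [hc]; simp only [mul_assoc]
    _ = s := by rw [h, ← mul_assoc s, mul_inv_mul, ← mul_assoc, mul_inv_mul]

theorem natLE_of_mul_eq {m s : S} (h : m⁻¹ * (m * s) = s) : NatLE (s * s⁻¹) (m⁻¹ * m) :=
  ⟨s * s⁻¹, idem_mul_inv s, by rw [← mul_assoc, mul_assoc m⁻¹, h]⟩

theorem mul_eq_of_natLE {m s : S} (h : NatLE (s * s⁻¹) (m⁻¹ * m)) : m⁻¹ * (m * s) = s := by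
  have := h.mul_eq (idem_mul_inv s)
  calc m⁻¹ * (m * s) = (m⁻¹ * m * (s * s⁻¹)) * s := by
        simp only [mul_assoc]; rw [← mul_assoc s, mul_inv_mul]
    _ = s := by rw [this, mul_inv_mul]

end

theorem wordInv_of {X : Type u} (l : X ⊕ X) :
    wordInv (FreeMonoid.of l) = FreeMonoid.of l.swap := rfl

theorem wordInv_reverse {X : Type u} (w : Words X) : (wordInv w).reverse = wordInv w.reverse := by
  have : ∀ l : List (X ⊕ X), (l.map Sum.swap).reverse.reverse = (l.reverse.map Sum.swap).reverse :=
    fun l => by simp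
  exact this w

theorem rho_wordInv {X : Type u} (w : Words X) : rho X (wordInv w) = (rho X w)⁻¹ := rfl

end InverseMonoid

/-! ### Paths in the Schützenberger graph and their labels -/

namespace InverseMonoidPresentation

open InverseMonoid

variable {X : Type u} {M : Type v} [InverseMonoid M] (P : InverseMonoidPresentation X M)

theorem phi_swap (l : X ⊕ X) :
    P.phi (FreeMonoid.of l.swap) = (P.phi (FreeMonoid.of l))⁻¹ := by
  exact map_inv' P.theta (rho X (FreeMonoid.of l))

variable {e : {e : M // IsIdempotentElem e}}

/-- The vertices of the graph `Sch(M,X,e)` with its edges traversable in both directions. -/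
abbrev Vertex (e : {e : M // IsIdempotentElem e}) := Quiver.Symmetrify (P.SchComp e)

variable {P}

/-- The element of `M` that a vertex is. -/
def Vertex.val (s : P.Vertex e) : M := s.1

theorem Vertex.greenL (s : P.Vertex e) : GreenL s.val e.1 := s.2

theorem Vertex.ext {s t : P.Vertex e} (h : s.val = t.val) : s = t := Subtype.ext h

/-- The order condition on edges is exactly what lets the inverse letter undo the letter. Each end
of an edge is then determined by the other end and the label. -/
theorem letter_spec {s t : P.Vertex e} (a : s ⟶ t) :
    t.val = P.phi (FreeMonoid.of (P.letter a)) * s.val ∧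
      s.val = P.phi (FreeMonoid.of (P.letter a).swap) * t.val := by
  rcases a with ⟨x, h1, h2⟩ | ⟨x, h1, h2⟩
  · rw [map_mul, map_inv'] at h1
    refine ⟨h2, ?_⟩
    rw [phi_swap]
    change s.val = (P.theta (FIM.of x))⁻¹ * t.val
    rw [show t.val = P.theta (FIM.of x) * s.val from h2]
    exact (mul_eq_of_natLE h1).symm
  · rw [map_mul, map_inv'] at h1
    refine ⟨?_, h2⟩
    have : P.phi (FreeMonoid.of (Sum.inr x)) = (P.theta (FIM.of x))⁻¹ := P.phi_swap (Sum.inl x)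
    change t.val = P.phi (FreeMonoid.of (Sum.inr x)) * s.val
    rw [this, show s.val = P.theta (FIM.of x) * t.val from h2]
    exact (mul_eq_of_natLE h1).symm

theorem exists_arrow (s : P.Vertex e) (l : X ⊕ X)
    (h : GreenL (P.phi (FreeMonoid.of l) * s.val) e.1) :
    ∃ (t : P.Vertex e) (a : s ⟶ t), P.letter a = l := by
  have hc := inv_mul_mul_cancel_of_greenL (h.trans s.greenL.symm)
  rcases l with x | x
  · refine ⟨⟨_, h⟩, Sum.inl ⟨x, ?_, rfl⟩, rfl⟩
    rw [map_mul, map_inv']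
    exact natLE_of_mul_eq hc
  · have hx : P.phi (FreeMonoid.of (Sum.inr x)) = (P.theta (FIM.of x))⁻¹ := P.phi_swap (Sum.inl x)
    rw [hx] at h hc
    rw [inv_inv'] at hc
    -- An inverse letter runs along an edge from `t` to `s`, so the order condition has to be
    -- checked at `t` rather than at `s`.
    obtain ⟨t, ht⟩ : ∃ t : P.Vertex e, t.val = (P.theta (FIM.of x))⁻¹ * s.val := ⟨⟨_, h⟩, rfl⟩
    rw [← ht] at hc
    refine ⟨t, Sum.inr ⟨x, ?_, hc.symm⟩, rfl⟩
    rw [map_mul, map_inv']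
    exact natLE_of_mul_eq (s := t.val) (by rw [hc, ht])

theorem letter_injective {s t : P.Vertex e} : Function.Injective (P.letter (s := s) (t := t)) := by
  rintro (⟨x, h⟩ | ⟨x, h⟩) (⟨y, k⟩ | ⟨y, k⟩) hxy
  · cases Sum.inl.inj hxy; rfl
  · cases hxy
  · cases hxy
  · cases Sum.inr.inj hxy; rfl

theorem letter_reverse {s t : P.Vertex e} (a : s ⟶ t) :
    P.letter (Quiver.reverse a) = (P.letter a).swap := by
  rcases a with x | x <;> rfl

theorem label_comp {s t : P.Vertex e} (p : Quiver.Path s t) :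
    ∀ {r : P.Vertex e} (q : Quiver.Path t r), P.label (p.comp q) = P.label p * P.label q
  | _, .nil => (mul_one _).symm
  | _, .cons q a => by
    rw [Quiver.Path.comp_cons, label, label_comp p q, mul_assoc]; rfl

theorem label_toPath {s t : P.Vertex e} (a : s ⟶ t) :
    P.label a.toPath = FreeMonoid.of (P.letter a) := one_mul _

theorem label_reverse {s : P.Vertex e} :
    ∀ {t : P.Vertex e} (p : Quiver.Path s t), P.label p.reverse = wordInv (P.label p)
  | _, .nil => rfl
  | _, .cons p a => by
    rw [Quiver.Path.reverse, label_comp, label_toPath, letter_reverse, label_reverse p, label,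
      wordInv_mul, wordInv_of]

theorem val_eq_phi_mul {s : P.Vertex e} :
    ∀ {t : P.Vertex e} (p : Quiver.Path s t), t.val = P.phi (P.label p).reverse * s.val
  | _, .nil => by
    have : P.phi (1 : Words X).reverse = 1 := map_one P.phi
    change s.val = P.phi (1 : Words X).reverse * s.val
    rw [this, one_mul]
  | _, .cons p a => by
    rw [label, FreeMonoid.reverse_mul, map_mul, mul_assoc, ← val_eq_phi_mul p,
      FreeMonoid.reverse_of, ← (letter_spec a).1]

/-- Only the final element needs to be tested: `GreenL.of_mul_mul` puts every intermediate one in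
the `L`-class. -/
theorem exists_path (w : Words X) : ∀ s : P.Vertex e,
    GreenL (P.phi w.reverse * s.val) e.1 →
      ∃ (t : P.Vertex e) (p : Quiver.Path s t), P.label p = w := by
  induction w using FreeMonoid.inductionOn' with
  | one => exact fun s _ => ⟨s, .nil, rfl⟩
  | of_mul l w ih =>
    intro s h
    rw [FreeMonoid.reverse_mul, map_mul, mul_assoc, FreeMonoid.reverse_of] at h
    obtain ⟨t, a, rfl⟩ := exists_arrow s l (s.greenL.of_mul_mul h)
    rw [← (letter_spec a).1] at h
    obtain ⟨r, p, rfl⟩ := ih t h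
    exact ⟨r, a.toPath.comp p, by rw [label_comp, label_toPath]⟩

theorem label_injective {s : P.Vertex e} :
    ∀ {t : P.Vertex e} (p q : Quiver.Path s t), P.label p = P.label q → p = q
  | _, .nil, .nil, _ => rfl
  | _, .nil, .cons q b, h => by
    have := congrArg FreeMonoid.length h
    simp [label] at this
  | _, .cons p a, .nil, h => by
    have := congrArg FreeMonoid.length h
    simp [label] at this
  | t, @Quiver.Path.cons _ _ _ r _ p a, @Quiver.Path.cons _ _ _ r' _ q b, h => by
    have key : P.label p = P.label q ∧ P.letter a = P.letter b := by
      have := List.append_inj' (show (P.label p).toList ++ [P.letter a] =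
        (P.label q).toList ++ [P.letter b] from h) rfl
      exact ⟨this.1, List.singleton_inj.1 this.2⟩
    -- Paths grow at their end, so the last edges are compared first; a common target and label
    -- force a common source.
    obtain rfl : r = r' := Vertex.ext (by rw [(letter_spec a).2, (letter_spec b).2, key.2])
    rw [label_injective p q key.1, letter_injective key.2]

/-- The path is not cut: `u` and then `w` are run afresh from `s`, and uniqueness of labelled paths
identifies the result with `p`. -/
theorem exists_comp_of_label_eq_mul {s t : P.Vertex e} (p : Quiver.Path s t) {u w : Words X}
    (h : P.label p = u * w) : ∃ (r : P.Vertex e) (p₁ : Quiver.Path s r) (p₂ : Quiver.Path r t),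
      p = p₁.comp p₂ ∧ P.label p₁ = u ∧ P.label p₂ = w := by
  have ht := t.greenL
  have hp := val_eq_phi_mul p
  rw [h, FreeMonoid.reverse_mul, map_mul, mul_assoc] at hp
  rw [hp] at ht
  obtain ⟨r, p₁, h₁⟩ := exists_path u s (s.greenL.of_mul_mul ht)
  rw [← h₁, ← val_eq_phi_mul p₁] at ht hp
  obtain ⟨t', p₂, h₂⟩ := exists_path w r ht
  obtain rfl : t' = t := Vertex.ext (by rw [hp, val_eq_phi_mul p₂, h₂])
  exact ⟨r, p₁, p₂, label_injective _ _ (by rw [label_comp, h, h₁, h₂]), h₁, h₂⟩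

end InverseMonoidPresentation

/-! ### Wagner-equivalent words and homotopy of paths -/

namespace InverseMonoidPresentation

open InverseMonoid CategoryTheory

variable {X : Type u} {M : Type v} [InverseMonoid M] {P : InverseMonoidPresentation X M}
  {e : {e : M // IsIdempotentElem e}}

/-- The object of the free groupoid given by a vertex. -/
abbrev Vertex.obj (s : P.Vertex e) : Quiver.FreeGroupoid (P.SchComp e) :=
  (Quiver.FreeGroupoid.of (P.SchComp e)).obj s

/-- The homotopy class of an edge path, as an arrow of the free groupoid. -/
def pathClass {s t : P.Vertex e} (p : Quiver.Path s t) : s.obj ⟶ t.obj :=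
  (CategoryTheory.Quotient.functor (@Quiver.FreeGroupoid.redStep (P.SchComp e) _)).map p

theorem pathClass_comp {s t r : P.Vertex e} (p : Quiver.Path s t) (q : Quiver.Path t r) :
    pathClass (p.comp q) = pathClass p ≫ pathClass q := rfl

theorem pathClass_comp_reverse {s t : P.Vertex e} (p : Quiver.Path s t) :
    pathClass p ≫ pathClass p.reverse = 𝟙 s.obj :=
  Quiver.FreeGroupoid.congr_comp_reverse p

variable (P e) in
/-- Every edge path with label `u` is homotopic to one with label `w` and the same endpoints. -/
def LabelHomotopy (u w : Words X) : Prop :=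
  ∀ ⦃s t : P.Vertex e⦄ (p : Quiver.Path s t), P.label p = u →
    ∃ q : Quiver.Path s t, P.label q = w ∧ pathClass q = pathClass p

theorem LabelHomotopy.mul {u w u' w' : Words X} (h : P.LabelHomotopy e u w)
    (h' : P.LabelHomotopy e u' w') : P.LabelHomotopy e (u * u') (w * w') := by
  intro s t p hp
  obtain ⟨r, p₁, p₂, rfl, h₁, h₂⟩ := exists_comp_of_label_eq_mul p hp
  obtain ⟨q₁, k₁, l₁⟩ := h p₁ h₁
  obtain ⟨q₂, k₂, l₂⟩ := h' p₂ h₂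
  exact ⟨q₁.comp q₂, by rw [label_comp, k₁, k₂], by rw [pathClass_comp, l₁, l₂, pathClass_comp]⟩

/-- A path whose label starts with `w * w⁻¹` starts with a path followed by its reverse. -/
theorem exists_of_label_eq_mul_wordInv_mul {s t : P.Vertex e} (p : Quiver.Path s t)
    {w z : Words X} (h : P.label p = w * wordInv w * z) :
    ∃ (r : P.Vertex e) (p₁ : Quiver.Path s r) (p₂ : Quiver.Path s t),
      p = (p₁.comp p₁.reverse).comp p₂ ∧ P.label p₁ = w ∧ P.label p₂ = z := by
  rw [mul_assoc] at h
  obtain ⟨r, p₁, q, rfl, h₁, hq⟩ := exists_comp_of_label_eq_mul p h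
  obtain ⟨s', p₂, p₃, rfl, h₂, h₃⟩ := exists_comp_of_label_eq_mul q hq
  -- `p₂` leaves the end of `p₁` with the same label as `p₁.reverse`, so it also ends at `s`.
  obtain rfl : s' = s := Vertex.ext (by
    have h₄ := val_eq_phi_mul p₁.reverse
    rw [val_eq_phi_mul p₂, h₂, h₄, label_reverse, h₁])
  obtain rfl : p₂ = p₁.reverse := label_injective _ _ (by rw [h₂, label_reverse, h₁])
  exact ⟨r, p₁, p₃, (Quiver.Path.comp_assoc _ _ _).symm, h₁, h₃⟩

theorem pathClass_comp_reverse_comp {s t r : P.Vertex e} (p : Quiver.Path s r)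
    (q : Quiver.Path s t) : pathClass ((p.comp p.reverse).comp q) = pathClass q := by
  rw [pathClass_comp, pathClass_comp, pathClass_comp_reverse, Category.id_comp]

theorem labelHomotopy_regular (w : Words X) : P.LabelHomotopy e (w * wordInv w * w) w := by
  intro s t p hp
  obtain ⟨r, p₁, p₂, rfl, -, h₂⟩ := exists_of_label_eq_mul_wordInv_mul p hp
  exact ⟨p₂, h₂, (pathClass_comp_reverse_comp _ _).symm⟩

theorem labelHomotopy_regular_symm (w : Words X) :
    P.LabelHomotopy e w (w * wordInv w * w) := by
  rintro s t p rfl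
  exact ⟨(p.comp p.reverse).comp p, by rw [label_comp, label_comp, label_reverse],
    pathClass_comp_reverse_comp _ _⟩

/-- Both detours start and end at `s`, so they can be made in either order, and each is
null-homotopic. -/
theorem labelHomotopy_commute (w z : Words X) :
    P.LabelHomotopy e (w * wordInv w * (z * wordInv z)) (z * wordInv z * (w * wordInv w)) := by
  intro s t p hp
  obtain ⟨r, p₁, p₂, rfl, h₁, h₂⟩ := exists_of_label_eq_mul_wordInv_mul p hp
  rw [← mul_one (z * wordInv z)] at h₂
  obtain ⟨r', p₃, p₄, rfl, h₃, h₄⟩ := exists_of_label_eq_mul_wordInv_mul p₂ h₂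
  refine ⟨(p₃.comp p₃.reverse).comp ((p₁.comp p₁.reverse).comp p₄), ?_, ?_⟩
  · simp only [label_comp, label_reverse, h₁, h₃, h₄, mul_one]
  · simp only [pathClass_comp_reverse_comp]

/-- Reversal commutes with formal inversion, so it turns the Wagner pairs into pairs of the same
kind. Both directions are carried along because a single `LabelHomotopy` is not visibly symmetric.
-/
theorem labelHomotopy_of_wagnerCon {u w : Words X} (h : wagnerCon X u w) :
    P.LabelHomotopy e u.reverse w.reverse ∧ P.LabelHomotopy e w.reverse u.reverse := by
  change ConGen.Rel (WagnerRel X) u w at h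
  induction h with
  | of u w h =>
    cases h with
    | regular w =>
      rw [FreeMonoid.reverse_mul, FreeMonoid.reverse_mul, wordInv_reverse, ← mul_assoc]
      exact ⟨labelHomotopy_regular _, labelHomotopy_regular_symm _⟩
    | commute w z =>
      have h (w z : Words X) : (w * wordInv w * (z * wordInv z)).reverse =
          wordInv z.reverse * wordInv (wordInv z.reverse) *
            (wordInv w.reverse * wordInv (wordInv w.reverse)) := by
        simp only [FreeMonoid.reverse_mul, wordInv_reverse, wordInv_wordInv]
      rw [h, h]
      exact ⟨labelHomotopy_commute _ _, labelHomotopy_commute _ _⟩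
  | refl u => exact ⟨fun _ _ p hp => ⟨p, hp, rfl⟩, fun _ _ p hp => ⟨p, hp, rfl⟩⟩
  | symm _ ih => exact ih.symm
  | trans _ _ ih₁ ih₂ =>
    have trans {a b c : Words X} (h : P.LabelHomotopy e a b) (k : P.LabelHomotopy e b c) :
        P.LabelHomotopy e a c := fun s t p hp => by
      obtain ⟨q, hq, hqp⟩ := h p hp
      obtain ⟨r, hr, hrq⟩ := k q hq
      exact ⟨r, hr, hrq.trans hqp⟩
    exact ⟨trans ih₁.1 ih₂.1, trans ih₂.2 ih₁.2⟩
  | mul _ _ ih₁ ih₂ =>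
    rw [FreeMonoid.reverse_mul, FreeMonoid.reverse_mul]
    exact ⟨ih₂.1.mul ih₁.1, ih₂.2.mul ih₁.2⟩

theorem pathClass_eq_of_rho_eq {s t : P.Vertex e} {p q : Quiver.Path s t}
    (h : rho X (P.label p).reverse = rho X (P.label q).reverse) : pathClass p = pathClass q := by
  obtain ⟨q', hq', hc⟩ := (labelHomotopy_of_wagnerCon (P := P) (e := e)
    ((wagnerCon X).eq.1 h)).1 p FreeMonoid.reverse_reverse.symm
  rw [FreeMonoid.reverse_reverse] at hq'
  rw [← hc, label_injective q' q hq']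

/-! ### Homotopy invariance of the value of a path in `T(M,X)` -/

/-- The element of `T(M,X)` that is read off an edge path from right to left. -/
def pathValue {s t : P.Vertex e} (p : Quiver.Path s t) : P.T :=
  P.tau (rho X (P.label p).reverse)

theorem psi_pathValue {s t : P.Vertex e} (p : Quiver.Path s t) :
    P.psi (pathValue p) = P.phi (P.label p).reverse := rfl

theorem pathValue_comp {s t r : P.Vertex e} (p : Quiver.Path s t) (q : Quiver.Path t r) :
    pathValue (p.comp q) = pathValue q * pathValue p := by
  rw [pathValue, label_comp, FreeMonoid.reverse_mul, map_mul, map_mul]; rfl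

theorem pathValue_reverse {s t : P.Vertex e} (p : Quiver.Path s t) :
    pathValue p.reverse = (pathValue p)⁻¹ := by
  rw [pathValue, label_reverse, wordInv_reverse, rho_wordInv, map_inv']; rfl

/-- The detour contributes an idempotent. Its product with `a * a⁻¹` is an idempotent with the same
`ψ`-image as `a * a⁻¹`, hence equal to it, because `ψ` separates idempotents. -/
theorem pathValue_comp_reverse_mul {s t : P.Vertex e} (p : Quiver.Path s t) {a : P.T}
    (h : P.psi a = s.val) : pathValue (p.comp p.reverse) * a = a := by
  rw [pathValue_comp, pathValue_reverse]
  have hp := val_eq_phi_mul (p.comp p.reverse)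
  rw [← psi_pathValue, pathValue_comp, pathValue_reverse, ← h, ← map_mul] at hp
  have : (pathValue p)⁻¹ * pathValue p * (a * a⁻¹) = a * a⁻¹ := by
    refine P.psi_idem_sep (idem_mul_idem (idem_inv_mul _) (idem_mul_inv _)) (idem_mul_inv _) ?_
    rw [← mul_assoc, map_mul, ← hp, ← map_mul]
  rw [← mul_inv_mul a, ← mul_assoc, this]

/-- The initial path `f` carries `a` to an element over `b`, where the detour acts trivially. This
is why `a` may lie over any vertex. -/
theorem pathValue_insert_mul {s t b c : P.Vertex e} (f : Quiver.Path s b) (p : Quiver.Path b c)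
    (g : Quiver.Path b t) {a : P.T} (ha : P.psi a = s.val) :
    pathValue (f.comp ((p.comp p.reverse).comp g)) * a = pathValue (f.comp g) * a := by
  have key := pathValue_comp_reverse_mul p (a := pathValue f * a) (by
    rw [map_mul, ha, psi_pathValue, ← val_eq_phi_mul f])
  rw [pathValue_comp f, pathValue_comp _ g, pathValue_comp f, mul_assoc, mul_assoc, key,
    ← mul_assoc]

theorem pathValue_congr_redStep {s t : P.Vertex e} {p q : Quiver.Path s t}
    (h : @HomRel.CompClosure (Paths (P.Vertex e)) _ Quiver.FreeGroupoid.redStep s t p q) {a : P.T}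
    (ha : P.psi a = s.val) : pathValue p * a = pathValue q * a := by
  obtain ⟨b, c, f, m₁, m₂, g, h⟩ := h
  cases h with
  | step _ z d =>
    refine Eq.trans ?_ (pathValue_insert_mul (P := P) (e := e) f (Quiver.Hom.toPath d) g ha).symm
    exact congrArg (fun g' => pathValue (P := P) (e := e) (Quiver.Path.comp f g') * a)
      (Quiver.Path.nil_comp g)

/-! ### The isomorphism from the fundamental group to `K_e` -/

theorem tilde_mul (a : P.K e) : P.tilde e * a.1 = a.1 := congrArg Subtype.val (one_mul a)

theorem mul_tilde (a : P.K e) : a.1 * P.tilde e = a.1 := congrArg Subtype.val (mul_one a)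

variable (P e) in
/-- The vertex `e`. -/
abbrev baseVertex : P.Vertex e := P.base e

theorem baseVertex_val : (P.baseVertex e).val = e.1 := rfl

theorem psi_pathValue_mul_tilde (p : Quiver.Path (P.baseVertex e) (P.baseVertex e)) :
    P.psi (pathValue p * P.tilde e) = e.1 := by
  rw [map_mul, psi_tilde, psi_pathValue, ← baseVertex_val (P := P), ← val_eq_phi_mul p]

/-- The element of `K_e` read off a closed path from right to left. -/
noncomputable def closedPathValue (p : P.ClosedPath e) : P.K e :=
  ⟨P.tau (rho X (P.label p).reverse) * P.tilde e, psi_pathValue_mul_tilde p⟩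

/-- The element of `K_e` read off a homotopy class of closed paths from right to left. -/
noncomputable def classValue (γ : P.FundGroup e) : P.K e :=
  Quot.liftOn γ closedPathValue
    fun _ _ h => Subtype.ext (pathValue_congr_redStep h (P.psi_tilde e))

theorem classValue_homotopyClass (p : P.ClosedPath e) :
    classValue (P.homotopyClass p) = closedPathValue p := rfl

theorem homotopyClass_surjective (γ : P.FundGroup e) : ∃ p, P.homotopyClass p = γ :=
  Quot.exists_rep γ

theorem homotopyClass_comp (p q : P.ClosedPath e) :
    P.homotopyClass (p.comp q) = P.homotopyClass p * P.homotopyClass q := rfl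

theorem closedPathValue_comp (p q : P.ClosedPath e) :
    closedPathValue (p.comp q) = closedPathValue q * closedPathValue p := by
  apply Subtype.ext
  change pathValue (s := P.baseVertex e) (t := P.baseVertex e) (p.comp q) * P.tilde e =
    pathValue q * P.tilde e * (closedPathValue p).1
  rw [mul_assoc, tilde_mul]
  exact (congrArg (· * P.tilde e) (pathValue_comp p q)).trans (mul_assoc _ _ _)

theorem classValue_mul (γ δ : P.FundGroup e) :
    classValue (γ * δ) = classValue δ * classValue γ := by
  obtain ⟨p, rfl⟩ := homotopyClass_surjective γ
  obtain ⟨q, rfl⟩ := homotopyClass_surjective δ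
  exact closedPathValue_comp p q

theorem exists_closedPath {w : Words X} (h : P.phi w.reverse * e.1 = e.1) :
    ∃ p : P.ClosedPath e, P.label p = w := by
  obtain ⟨t, p, hp⟩ := exists_path (P := P) (e := e) w (P.baseVertex e) (by
    rw [baseVertex_val, h]; rfl)
  obtain rfl : t = P.baseVertex e := Vertex.ext (by rw [val_eq_phi_mul p, hp, baseVertex_val, h])
  exact ⟨p, hp⟩

theorem classValue_surjective : Function.Surjective (classValue (P := P) (e := e)) := by
  rintro a
  obtain ⟨b, hb⟩ := P.tau_surjective a.1
  obtain ⟨w, rfl⟩ := Con.mk'_surjective b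
  have hw : P.phi w = e.1 := by
    change P.psi (P.tau (rho X w)) = e.1
    exact (congrArg P.psi hb).trans a.2
  obtain ⟨p, hp⟩ := exists_closedPath (P := P) (e := e) (w := w.reverse)
    (by rw [FreeMonoid.reverse_reverse, hw, e.2.eq])
  refine ⟨P.homotopyClass p, Subtype.ext ?_⟩
  rw [classValue_homotopyClass]
  change P.tau (rho X (P.label p).reverse) * P.tilde e = a.1
  rw [hp, FreeMonoid.reverse_reverse]
  exact (congrArg (· * P.tilde e) hb).trans (mul_tilde a)

/-- An equality in `T(M,X)` becomes one in `FIM(X)` after right multiplication by an idempotent `f`.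
The factor so introduced is realised by a closed path `q` traversed before `p`, which then cancels
in the group. -/
theorem homotopyClass_eq_one {p : P.ClosedPath e} (h : closedPathValue p = 1) :
    P.homotopyClass p = 1 := by
  obtain ⟨a, ha⟩ := P.tau_surjective (P.tilde e)
  have h : P.tau (rho X (P.label p).reverse) * P.tilde e = P.tilde e := congrArg Subtype.val h
  rw [← ha, ← map_mul] at h
  obtain ⟨f, hf, hpf, -, hfa⟩ := (minCon (Con.ker P.theta)).eq.1 h
  -- The clause of `θ_min` that ties `f` to `a⁻¹ * a` keeps `a * f` over `e`; without it a word for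
  -- `a * f` need not label a closed path at `e`.
  have hza : P.theta (a * f) = e.1 := by
    have h₁ : P.theta f = P.theta (a⁻¹ * a) := hfa
    rw [map_mul, h₁, ← map_mul, ← mul_assoc, mul_inv_mul, ← psi_tau, ha, psi_tilde]
  obtain ⟨z, hz⟩ := Con.mk'_surjective (a * f)
  have hzφ : P.phi z = e.1 := (congrArg P.theta hz).trans hza
  obtain ⟨q, hq⟩ := exists_closedPath (P := P) (e := e) (w := z.reverse)
    (by rw [FreeMonoid.reverse_reverse, hzφ, e.2.eq])
  have key : P.homotopyClass (q.comp p) = P.homotopyClass q := by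
    refine pathClass_eq_of_rho_eq (P := P) (e := e) ?_
    have hqp : P.label (q.comp p) = P.label q * P.label p := label_comp (P := P) (e := e) q p
    rw [hqp, FreeMonoid.reverse_mul, map_mul, hq, FreeMonoid.reverse_reverse]
    have hz : rho X z = a * f := hz
    rw [hz, ← mul_assoc, hpf]
  rw [homotopyClass_comp] at key
  exact mul_eq_left.1 key

/-- The isomorphism of the fundamental group of `Sch(M,X,e)` with `K_e`. -/
noncomputable def fundGroupEquiv : P.FundGroup e ≃* P.K e :=
  MulEquiv.ofBijective
    -- Inversion turns the anti-homomorphism `classValue` into a homomorphism.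
    (MonoidHom.mk' (fun γ => (classValue γ)⁻¹) fun γ δ => by rw [classValue_mul, mul_inv_rev])
    ⟨(injective_iff_map_eq_one _).2 fun γ h => by
        obtain ⟨p, rfl⟩ := homotopyClass_surjective γ
        exact homotopyClass_eq_one (inv_eq_one.1 h),
      inv_surjective.comp classValue_surjective⟩

end InverseMonoidPresentation

theorem mainTheorem4 {X : Type u} {M : Type v} [InverseMonoid M]
    (P : InverseMonoidPresentation X M) (e : {e : M // IsIdempotentElem e}) :
    Set.BijOn (fun p : P.ClosedPath e => P.label p) Set.univ
        {w : InverseMonoid.Words X | w.reverse ∈ P.U e} ∧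
      ∃ κ : P.FundGroup e ≃* P.K e, ∀ p : P.ClosedPath e,
        (κ (P.homotopyClass p)).1 =
          (P.tau (InverseMonoid.rho X (P.label p).reverse) * P.tilde e)⁻¹ := by
  open InverseMonoidPresentation in
  -- The idempotent witnessing `(rev w)φ ≥ e` is `e` itself, since a closed path at `e` gives `e =
  -- (rev w)φ · e`.
  refine ⟨⟨fun p _ => ⟨e.1, e.2, val_eq_phi_mul p⟩,
    fun p _ q _ h => label_injective p q h, fun w hw => ?_⟩, fundGroupEquiv, fun p => rfl⟩
  obtain ⟨p, hp⟩ := InverseMonoidPresentation.exists_closedPath (hw.mul_eq e.2)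
  exact ⟨p, trivial, hp⟩
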